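/- Let $(M,g)$ be a connected Lorentzian spin manifold, i.e. a connected smooth manifold of dimension $n$ with a smooth metric $g$ of signature $(-,+,\dots,+)$ that is space- and time-oriented and is equipped with a spin structure (for the group $\mathrm{Spin}^+(1,n-1)$). Let $\Sigma$ be its complex spinor bundle, with Clifford multiplication satisfying $X\cdot Y\cdot\varphi+Y\cdot X\cdot\varphi=-2g(X,Y)\varphi$, with the Hermitian bundle metric $\langle\cdot,\cdot\rangle$ (conjugate-linear in the second entry) induced by the $\mathrm{Spin}^+(1,n-1)$-invariant Hermitian form $\langle u,v\rangle=(e_0\cdot u,v)$ on the irreducible complex spinor module of dimension $2^{\lfloor n/2\rfloor}$ (here $e_0,\dots,e_{n-1}$ is the standard basis of Minkowski space with $e_0$ time-like, and $(\cdot,\cdot)$ is the standard positive definite Hermitian inner product, for which $e_0$ acts by a self-adjoint and $e_1,\dots,e_{n-1}$ by skew-adjoint endomorphisms), and with the lift $\nabla^\Sigma$ of the Levi-Civita connection $\nabla$ of $g$. Let $\varphi$ be a smooth parallel spinor field, $\nabla^\Sigma\varphi=0$, that is not identically zero. Then: 1. there is a unique (real) vector field $V_\varphi$ on $M$, the Dirac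 current of $\varphi$, such that $$g(V_\varphi,X)=i^{2}\langle\varphi,X\cdot\varphi\rangle=-\langle\varphi,X\cdot\varphi\rangle\qquad\text{for all } X\in TM,$$ and $V_\varphi$ is smooth; 2. $V_\varphi$ vanishes at no point of $M$; 3. $V_\varphi$ is parallel, $\nabla V_\varphi=0$; 4. $g(V_\varphi,V_\varphi)\le 0$ everywhere on $M$. In particular $V_\varphi$ is a causal parallel vector field. -/

import Mathlib

open scoped Manifold ContDiff

noncomputable section

namespace SpinLorentz

/-! ### The model: Minkowski space, its Clifford algebra, and the spinor module -/

/-- The signs `ε_a` of the Minkowski metric on `ℝ^(m+1)`: one minus sign, in position `0`. -/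
def sgn {m : ℕ} (a : Fin (m + 1)) : ℝ := if a = 0 then -1 else 1

/-- The quadratic form `v ↦ -η(v, v)`, where `η = diag(-1, 1, …, 1)`. Since Mathlib's Clifford
relation is `v * v = Q v`, this choice of `Q` gives the relation `v * w + w * v = -2 η(v, w)`. -/
def cliffordForm (m : ℕ) : QuadraticForm ℝ (Fin (m + 1) → ℝ) :=
  QuadraticMap.weightedSumSquares ℝ (fun a : Fin (m + 1) => -sgn a)

/-- The real Clifford algebra of Minkowski space. Its `spinGroup` (even products of
vectors that satisfy `x * star x = 1`) is the double cover of the group `SO⁺(1, m)` of Lorentz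
transformations that preserve both the space and the time orientation. -/
abbrev Cl (m : ℕ) : Type := CliffordAlgebra (cliffordForm m)

/-- The complex spinor module `Δ ≅ (ℂ²)^{⊗ k}`, `k = ⌊(m+1)/2⌋`, of complex dimension `2^k`, with
its standard positive definite inner product; basis vectors are labelled by `k` bits. -/
abbrev Spinor (m : ℕ) : Type := EuclideanSpace ℂ (Fin ((m + 1) / 2) → Bool)

/-- Negates the bit in position `j` (does nothing if there is no such position). -/
def flipBit {k : ℕ} (j : ℕ) (b : Fin k → Bool) : Fin k → Bool :=
  fun i => if i.val = j then !(b i) else b i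

/-- The sign `(-1)^(b_0 + … + b_{l-1})`. -/
def paritySign {k : ℕ} (l : ℕ) (b : Fin k → Bool) : ℂ :=
  ∏ i : Fin k, if i.val < l ∧ b i = true then -1 else 1

/-- The standard anticommuting Hermitian involutions on `(ℂ²)^{⊗ k}` in terms of Pauli matrices:
number `2j` is `Z ⊗ … ⊗ Z ⊗ X ⊗ 1 ⊗ … ⊗ 1` and number `2j+1` is `Z ⊗ … ⊗ Z ⊗ Y ⊗ 1 ⊗ … ⊗ 1`
up to a global sign, with `X`, `Y` in position `j`; for `m + 1` odd the last one is
`Z ⊗ … ⊗ Z`. -/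
def pauli (m : ℕ) (a : ℕ) : Module.End ℂ (Spinor m) where
  toFun u := WithLp.toLp 2 fun b =>
    Complex.I ^ (a % 2) * paritySign ((a + 1) / 2) b * u (flipBit (a / 2) b)
  map_add' u v := by ext b; simp [mul_add]
  map_smul' c u := by ext b; simp; ring

/-- The gamma matrices: `γ_0² = 1`, `γ_a² = -1` for `a ≥ 1`. -/
def gamma (m : ℕ) (a : Fin (m + 1)) : Module.End ℂ (Spinor m) :=
  if a = 0 then pauli m a else Complex.I • pauli m a

lemma flip_flip {k : ℕ} (j : ℕ) (b : Fin k → Bool) : flipBit j (flipBit j b) = b := by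
  funext i; by_cases h : i.val = j <;> simp [flipBit, h]

lemma flip_comm {k : ℕ} (j l : ℕ) (b : Fin k → Bool) : flipBit j (flipBit l b) = flipBit l (flipBit j b) := by
  funext i; simp only [flipBit]; split_ifs <;> rfl

lemma paritySign_mul_self {k : ℕ} (l : ℕ) (b : Fin k → Bool) :
    paritySign l b * paritySign l b = 1 := by
  rw [paritySign, ← Finset.prod_mul_distrib]
  exact Finset.prod_eq_one fun i _ => by split_ifs <;> simp

lemma paritySign_flip_of_le {k : ℕ} {l j : ℕ} (h : l ≤ j) (b : Fin k → Bool) :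
    paritySign l (flipBit j b) = paritySign l b := by
  refine Finset.prod_congr rfl fun i _ => ?_
  by_cases hi : i.val = j
  · have : ¬ i.val < l := by omega
    simp [this]
  · simp [flipBit, hi]

lemma paritySign_flip_of_lt {k : ℕ} {l j : ℕ} (hk : j < k) (h : j < l) (b : Fin k → Bool) :
    paritySign l (flipBit j b) = -paritySign l b := by
  unfold paritySign
  rw [← Finset.mul_prod_erase _ _ (Finset.mem_univ (⟨j, hk⟩ : Fin k)),
    ← Finset.mul_prod_erase _ (fun i : Fin k => if i.val < l ∧ b i = true then (-1 : ℂ) else 1)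
      (Finset.mem_univ (⟨j, hk⟩ : Fin k)), ← neg_mul]
  congr 1
  · cases hb : b ⟨j, hk⟩ <;> simp [flipBit, h, hb]
  · refine Finset.prod_congr rfl fun i hi => ?_
    have : i.val ≠ j := fun e => (Finset.mem_erase.1 hi).1 (Fin.ext e)
    simp [flipBit, this]

lemma pauli_sq (m : ℕ) {a : ℕ} (ha : a ≤ m) : pauli m a * pauli m a = 1 := by
  ext u b
  simp only [pauli, Module.End.mul_apply, LinearMap.coe_mk, AddHom.coe_mk, flip_flip,
    Module.End.one_apply]
  rcases Nat.even_or_odd' a with ⟨j, rfl | rfl⟩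
  · have h := paritySign_mul_self ((2 * j + 1) / 2) b
    rw [paritySign_flip_of_le (by omega), Nat.mul_mod_right]
    linear_combination u b * h
  · have h := paritySign_mul_self ((2 * j + 1 + 1) / 2) b
    rw [paritySign_flip_of_lt (by omega) (by omega), show (2 * j + 1) % 2 = 1 by omega]
    linear_combination u b * h - u b * paritySign ((2 * j + 1 + 1) / 2) b ^ 2 * Complex.I_sq

lemma pauli_anticomm (m : ℕ) {a c : ℕ} (hac : a < c) (hc : c ≤ m) :
    pauli m a * pauli m c + pauli m c * pauli m a = 0 := by
  ext u b
  simp only [pauli, Module.End.mul_apply, LinearMap.coe_mk, AddHom.coe_mk, LinearMap.add_apply,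
    PiLp.add_apply, LinearMap.zero_apply, PiLp.zero_apply]
  rw [paritySign_flip_of_lt (j := a / 2) (by omega) (by omega),
    paritySign_flip_of_le (j := c / 2) (by omega), flip_comm (c / 2)]
  ring

lemma gamma_sq (m : ℕ) (a : Fin (m + 1)) :
    gamma m a * gamma m a = algebraMap ℝ (Module.End ℂ (Spinor m)) (-sgn a) := by
  have h := pauli_sq m (Nat.lt_succ_iff.1 a.2)
  by_cases ha : a = 0
  · rw [gamma, if_pos ha, h, sgn, if_pos ha]; simp
  · rw [gamma, if_neg ha, smul_mul_smul_comm, h, sgn, if_neg ha]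
    ext u b; simp

lemma gamma_anticomm (m : ℕ) {a c : Fin (m + 1)} (hac : a ≠ c) :
    gamma m a * gamma m c + gamma m c * gamma m a = 0 := by
  have key : pauli m a * pauli m c + pauli m c * pauli m a = 0 := by
    rcases lt_or_gt_of_ne (fun e => hac (Fin.ext e) : a.val ≠ c.val) with h | h
    · exact pauli_anticomm m h (Nat.lt_succ_iff.1 c.2)
    · rw [add_comm (pauli m a * pauli m c)]; exact pauli_anticomm m h (Nat.lt_succ_iff.1 a.2)
  have hx (x : Fin (m + 1)) : ∃ z : ℂ, gamma m x = z • pauli m x := by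
    by_cases h : x = 0
    · exact ⟨1, by rw [gamma, if_pos h, one_smul]⟩
    · exact ⟨Complex.I, by rw [gamma, if_neg h]⟩
  obtain ⟨z, hz⟩ := hx a
  obtain ⟨w, hw⟩ := hx c
  rw [hz, hw, smul_mul_smul_comm, smul_mul_smul_comm, mul_comm w z, ← smul_add, key, smul_zero]

/-- Clifford multiplication of spinors by vectors of Minkowski space: `v ↦ ∑ v_a γ_a`. -/
def gammaMap (m : ℕ) : (Fin (m + 1) → ℝ) →ₗ[ℝ] Module.End ℂ (Spinor m) :=
  Fintype.linearCombination ℝ (gamma m)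

lemma gammaMap_sq (m : ℕ) (v : Fin (m + 1) → ℝ) :
    gammaMap m v * gammaMap m v =
      algebraMap ℝ (Module.End ℂ (Spinor m)) (cliffordForm m v) := by
  have h1 : gammaMap m v * gammaMap m v =
      ∑ a, ∑ c, (v a * v c) • (gamma m a * gamma m c) := by
    simp only [gammaMap, Fintype.linearCombination_apply, Finset.sum_mul_sum,
      smul_mul_smul_comm]
  have h2 : gammaMap m v * gammaMap m v =
      ∑ a, ∑ c, (v a * v c) • (gamma m c * gamma m a) := by
    rw [h1, Finset.sum_comm]
    exact Finset.sum_congr rfl fun a _ => Finset.sum_congr rfl fun c _ => by rw [mul_comm (v c)]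
  have h3 : (2 : ℝ) • (gammaMap m v * gammaMap m v) =
      (2 : ℝ) • algebraMap ℝ (Module.End ℂ (Spinor m)) (cliffordForm m v) := by
    rw [two_smul]
    nth_rewrite 1 [h1]
    rw [h2, ← Finset.sum_add_distrib]
    have h5 (a : Fin (m + 1)) : ∑ c, (v a * v c) • (gamma m a * gamma m c) +
        ∑ c, (v a * v c) • (gamma m c * gamma m a) =
        ∑ c, (v a * v c) • (gamma m a * gamma m c + gamma m c * gamma m a) := by
      rw [← Finset.sum_add_distrib]
      simp only [smul_add]
    have h4 (a : Fin (m + 1)) : ∑ c, (v a * v c) • (gamma m a * gamma m c + gamma m c * gamma m a)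
        = (2 : ℝ) • algebraMap ℝ (Module.End ℂ (Spinor m)) (-sgn a * (v a * v a)) := by
      rw [Finset.sum_eq_single a]
      · rw [gamma_sq, ← two_smul ℝ, smul_comm, map_mul, ← Algebra.commutes, ← Algebra.smul_def]
      · intro c _ hc
        rw [gamma_anticomm m hc.symm, smul_zero]
      · simp
    simp only [h5, h4, ← Finset.smul_sum, ← map_sum]
    simp [cliffordForm, QuadraticMap.weightedSumSquares_apply]
  exact smul_right_injective _ (two_ne_zero (α := ℝ)) h3

/-- The complex spin representation: the irreducible action of the Clifford algebra on `Δ`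
extending `e_a ↦ γ_a`. -/
def spinRep (m : ℕ) : Cl m →ₐ[ℝ] Module.End ℂ (Spinor m) :=
  CliffordAlgebra.lift (cliffordForm m) ⟨gammaMap m, gammaMap_sq m⟩

/-- The `Spin⁺`-invariant Hermitian form `⟨u, v⟩ = (γ_0 u, v)` on `Δ`, conjugate-linear in `v`;
it is indefinite of neutral signature for `m ≥ 1`. -/
def spinForm {m : ℕ} (u v : Spinor m) : ℂ := inner ℂ v (gamma m 0 u)

/-! ### Lorentzian manifolds and the Levi-Civita connection -/

/-- A smooth Lorentzian metric of signature `(-, +, …, +)` on a manifold of dimension `m + 1`. -/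
structure LorentzianMetric (m : ℕ) (M : Type*) [TopologicalSpace M]
    [ChartedSpace (EuclideanSpace ℝ (Fin (m + 1))) M] [IsManifold (𝓡 (m + 1)) ∞ M] where
  val : ∀ x : M, TangentSpace (𝓡 (m + 1)) x →L[ℝ] TangentSpace (𝓡 (m + 1)) x →L[ℝ] ℝ
  symm : ∀ (x : M) (X Y : TangentSpace (𝓡 (m + 1)) x), val x X Y = val x Y X
  exists_orthonormal : ∀ x : M,
    ∃ b : Module.Basis (Fin (m + 1)) ℝ (TangentSpace (𝓡 (m + 1)) x),
      ∀ a c, val x (b a) (b c) = if a = c then sgn a else 0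
  contMDiff : ContMDiff (𝓡 (m + 1))
    ((𝓡 (m + 1)).prod 𝓘(ℝ, EuclideanSpace ℝ (Fin (m + 1)) →L[ℝ]
      EuclideanSpace ℝ (Fin (m + 1)) →L[ℝ] ℝ)) ∞
    (fun x => Bundle.TotalSpace.mk' (EuclideanSpace ℝ (Fin (m + 1)) →L[ℝ]
      EuclideanSpace ℝ (Fin (m + 1)) →L[ℝ] ℝ)
      (E := fun x : M => TangentSpace (𝓡 (m + 1)) x →L[ℝ] TangentSpace (𝓡 (m + 1)) x →L[ℝ] ℝ)
      x (val x))

section Manifold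

variable {m : ℕ} {M : Type*} [TopologicalSpace M]
  [ChartedSpace (EuclideanSpace ℝ (Fin (m + 1))) M] [IsManifold (𝓡 (m + 1)) ∞ M]

/-- The type of connections on the tangent bundle. In Mathlib's notation `∇ Y x X` is the value
at `x` of `∇_X Y`. -/
abbrev Connection (m : ℕ) (M : Type*) [TopologicalSpace M]
    [ChartedSpace (EuclideanSpace ℝ (Fin (m + 1))) M] [IsManifold (𝓡 (m + 1)) ∞ M] :=
  CovariantDerivative (𝓡 (m + 1)) (EuclideanSpace ℝ (Fin (m + 1)))
    (TangentSpace (𝓡 (m + 1)) : M → Type _)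

/-- `∇` is the Levi-Civita connection of `g`: it is torsion-free and metric. -/
structure IsLeviCivita (g : LorentzianMetric m M) (nabla : Connection m M) : Prop where
  torsion_eq_zero : nabla.torsion = 0
  metric : ∀ (Y Z : ∀ x : M, TangentSpace (𝓡 (m + 1)) x) (x : M),
    MDifferentiableAt (𝓡 (m + 1)) (𝓡 (m + 1)).tangent
      (fun y => (⟨y, Y y⟩ : TangentBundle (𝓡 (m + 1)) M)) x →
    MDifferentiableAt (𝓡 (m + 1)) (𝓡 (m + 1)).tangent
      (fun y => (⟨y, Z y⟩ : TangentBundle (𝓡 (m + 1)) M)) x →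
    ∀ X : TangentSpace (𝓡 (m + 1)) x,
      mvfderiv (𝓡 (m + 1)) (fun y => g.val y (Y y) (Z y)) x X =
        g.val x (nabla Y x X) (Z x) + g.val x (Y x) (nabla Z x X)

/-- The components `(ε_a g(X, e_a))_a` of a tangent vector with respect to an orthonormal frame. -/
def components (g : LorentzianMetric m M) {x : M}
    (e : Fin (m + 1) → TangentSpace (𝓡 (m + 1)) x) (X : TangentSpace (𝓡 (m + 1)) x) :
    Fin (m + 1) → ℝ :=
  fun a => sgn a * g.val x X (e a)

/-! ### Spin structures, spinor fields, the spin connection -/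

/-- A spin structure on a space- and time-oriented Lorentzian manifold, given by trivialisations
and transition functions: an open cover `U i`, smooth orthonormal frames over the `U i`, and
smooth `Spin⁺`-valued functions `h i j` on the overlaps that satisfy the cocycle condition and
cover the changes of frame. As the frames differ by elements of `SO⁺(1, m)`, they determine the
space and the time orientation. -/
structure SpinStructure (g : LorentzianMetric m M) (ι : Type*) where
  U : ι → Set M
  isOpen_U : ∀ i, IsOpen (U i)
  exists_mem_U : ∀ x, ∃ i, x ∈ U i
  frame : ι → Fin (m + 1) → ∀ x : M, TangentSpace (𝓡 (m + 1)) x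
  contMDiffOn_frame : ∀ i a, ContMDiffOn (𝓡 (m + 1)) (𝓡 (m + 1)).tangent ∞
    (fun x => (⟨x, frame i a x⟩ : TangentBundle (𝓡 (m + 1)) M)) (U i)
  orthonormal : ∀ i, ∀ x ∈ U i, ∀ a c,
    g.val x (frame i a x) (frame i c x) = if a = c then sgn a else 0
  h : ι → ι → M → Cl m
  mem_spin : ∀ i j, ∀ x ∈ U i ∩ U j, h i j x ∈ spinGroup (cliffordForm m)
  /-- Smoothness of a map into the finite-dimensional algebra `Cl m`, tested on coordinates. -/
  contMDiffOn_h : ∀ i j (f : Module.Dual ℝ (Cl m)),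
    ContMDiffOn (𝓡 (m + 1)) 𝓘(ℝ, ℝ) ∞ (fun x => f (h i j x)) (U i ∩ U j)
  cocycle : ∀ i j k, ∀ x ∈ U i ∩ U j ∩ U k, h i j x * h j k x = h i k x
  /-- The double cover `λ(s) v = s v s⁻¹` sends `h i j` to the change of components from the
  frame `j` to the frame `i`. -/
  covers : ∀ i j, ∀ x ∈ U i ∩ U j, ∀ X : TangentSpace (𝓡 (m + 1)) x,
    h i j x * CliffordAlgebra.ι (cliffordForm m) (components g (fun a => frame j a x) X) =
      CliffordAlgebra.ι (cliffordForm m) (components g (fun a => frame i a x) X) * h i j x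

variable {g : LorentzianMetric m M} {ι : Type*}

/-- A spinor field, i.e. a smooth section of the spinor bundle `Σ` associated with the spin
structure by the spin representation: smooth local functions `φ i : U i → Δ` with
`φ i = ρ(h i j) φ j` on the overlaps. The values of `φ i` outside `U i` are irrelevant. -/
structure SpinorField (S : SpinStructure g ι) where
  toFun : ι → M → Spinor m
  contMDiffOn : ∀ i, ContMDiffOn (𝓡 (m + 1)) 𝓘(ℝ, Spinor m) ∞ (toFun i) (S.U i)
  compatible : ∀ i j, ∀ x ∈ S.U i ∩ S.U j, toFun i x = spinRep m (S.h i j x) (toFun j x)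

namespace SpinorField

variable {S : SpinStructure g ι}

/-- Clifford multiplication `X · φ` at a point of `U i`, expressed in the trivialisation `i`. -/
def clifford (φ : SpinorField S) (i : ι) (x : M) (X : TangentSpace (𝓡 (m + 1)) x) : Spinor m :=
  spinRep m (CliffordAlgebra.ι (cliffordForm m) (components g (fun a => S.frame i a x) X))
    (φ.toFun i x)

/-- The lift `∇^Σ_X φ` of the connection `∇` to the spinor bundle, expressed in the
trivialisation `i`: `X(φ) + (1/4) ∑_{a,c} ε_a ε_c g(∇_X e_a, e_c) γ_a γ_c φ`. -/
def covDeriv (nabla : Connection m M) (φ : SpinorField S) (i : ι) (x : M)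
    (X : TangentSpace (𝓡 (m + 1)) x) : Spinor m :=
  mvfderiv (𝓡 (m + 1)) (φ.toFun i) x X +
    (1 / 4 : ℝ) • ∑ a, ∑ c,
      (sgn a * sgn c * g.val x (nabla (S.frame i a) x X) (S.frame i c x)) •
        gamma m a (gamma m c (φ.toFun i x))

/-- `φ` is a parallel spinor field: `∇^Σ φ = 0`. -/
def IsParallel (nabla : Connection m M) (φ : SpinorField S) : Prop :=
  ∀ i, ∀ x ∈ S.U i, ∀ X : TangentSpace (𝓡 (m + 1)) x, φ.covDeriv nabla i x X = 0

/-- `φ` is not the zero section. -/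
def IsNontrivial (φ : SpinorField S) : Prop := ∃ i, ∃ x ∈ S.U i, φ.toFun i x ≠ 0

/-- `V` is the Dirac current of `φ`: `g(V, X) = i^(r+1) ⟨φ, X · φ⟩` for all `X`, where `r = 1` is
the number of negative eigenvalues of `g`. -/
def IsDiracCurrent (φ : SpinorField S) (V : ∀ x : M, TangentSpace (𝓡 (m + 1)) x) : Prop :=
  ∀ i, ∀ x ∈ S.U i, ∀ X : TangentSpace (𝓡 (m + 1)) x,
    ((g.val x (V x) X : ℝ) : ℂ) =
      Complex.I ^ (1 + 1) * spinForm (φ.toFun i x) (φ.clifford i x X)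

end SpinorField

end Manifold

end SpinLorentz

end

/-!
Fix a spin structure and a parallel spinor field `φ`, and write `ω(X)` for the skew matrix of the
connection in one of its local orthonormal frames `e_0, …, e_m`. There `∇φ = 0` is the linear
first-order equation `dφ(X) = -(1/4) ∑ ω(X)_{ac} γ_a γ_c φ`. Its coefficients are locally bounded,
so Grönwall's inequality along segments in a chart makes the zero set of `φ` open; it is also
closed, so `φ` has no zeros.

In the frame the Dirac current has the coefficients `-ε_a ⟨φ, γ_a φ⟩`. The one along `e_0` is
`‖φ‖²`, so `V` has no zeros either. Let `n` be the spatial part of `V`; then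
`|n|² = -⟨φ, n · φ⟩ ≤ ‖n · φ‖ ‖φ‖ = |n| ‖φ‖²`, so `|n| ≤ ‖φ‖²` and `g(V, V) = |n|² - ‖φ‖⁴ ≤ 0`.

The endomorphism `(1/4) ∑ ω_{ac} γ_a γ_c` is skew for the spinor form, and its commutator with `γ_c`
is Clifford multiplication by `∇e_c`. Hence differentiating `g(V, e_c) = -⟨φ, γ_c φ⟩` gives
`g(V, ∇e_c)`, and metricity leaves `g(∇V, e_c) = 0`. The connection only has to be metric with
continuous coefficients; for the Levi-Civita connection the latter is Koszul's formula.
-/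

noncomputable section

namespace SpinLorentz

/-! ### Unique continuation for functions with `‖df‖ ≤ C ‖f‖` -/

section UniqueContinuation

open Filter Set Topology

section NormedSpace

variable {E G : Type*} [NormedAddCommGroup E] [NormedSpace ℝ E] [NormedAddCommGroup G]
  [NormedSpace ℝ G]

lemma eq_zero_of_norm_hasFDerivWithinAt_le {f : E → G} {f' : E → E →L[ℝ] G} {s : Set E} {C : ℝ}
    (hs : Convex ℝ s) (hf : ∀ y ∈ s, HasFDerivWithinAt f (f' y) s y)
    (hC : ∀ y ∈ s, ‖f' y‖ ≤ C * ‖f y‖) {x y : E} (hx : x ∈ s) (hy : y ∈ s) (h0 : f x = 0) :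
    f y = 0 := by
  let γ : ℝ → E := AffineMap.lineMap x y
  have hγ : MapsTo γ (Icc 0 1) s := fun t ht => hs.lineMap_mem hx hy ht
  have hderiv : ∀ t ∈ Icc (0 : ℝ) 1,
      HasDerivWithinAt (f ∘ γ) (f' (γ t) (y - x)) (Icc 0 1) t := fun t ht =>
    (hf _ (hγ ht)).comp_hasDerivWithinAt t AffineMap.hasDerivWithinAt_lineMap hγ
  have hzero := eq_zero_of_abs_deriv_le_mul_abs_self_of_eq_zero_right (f := f ∘ γ)
    (K := C * ‖y - x‖) (fun t ht => (hderiv t ht).continuousWithinAt)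
    (fun t ht => (hderiv t (Ico_subset_Icc_self ht)).mono_of_mem_nhdsWithin
      (Icc_mem_nhdsGE_of_mem ht))
    (by simpa [γ] using h0)
    (fun t ht => calc
      ‖f' (γ t) (y - x)‖ ≤ ‖f' (γ t)‖ * ‖y - x‖ := (f' (γ t)).le_opNorm _
      _ ≤ C * ‖f (γ t)‖ * ‖y - x‖ := by gcongr; exact hC _ (hγ (Ico_subset_Icc_self ht))
      _ = C * ‖y - x‖ * ‖f (γ t)‖ := by ring)
  simpa [γ] using hzero 1 (right_mem_Icc.2 zero_le_one)

end NormedSpace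

section Manifold

variable {E H M G : Type*} [NormedAddCommGroup E] [NormedSpace ℝ E] [TopologicalSpace H]
  {I : ModelWithCorners ℝ E H} [TopologicalSpace M] [ChartedSpace H M]
  [NormedAddCommGroup G] [NormedSpace ℝ G]

lemma hasFDerivWithinAt_comp_extChartAt_symm [IsManifold I 1 M] {f : M → G} {x : M} {u : E}
    (hu : u ∈ (extChartAt I x).target) (hf : MDiffAt f ((extChartAt I x).symm u)) :
    HasFDerivWithinAt (f ∘ (extChartAt I x).symm)
      ((d% f ((extChartAt I x).symm u)).comp
        ((trivializationAt E (TangentSpace I) x).symmL ℝ ((extChartAt I x).symm u)))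
      (range I) u := by
  have hsource : (extChartAt I x).symm u ∈ (chartAt H x).source := by
    simpa using (extChartAt I x).map_target hu
  rw [TangentBundle.symmL_trivializationAt hsource, (extChartAt I x).right_inv hu]
  exact (hf.hasMFDerivAt.comp_hasMFDerivWithinAt u
    (mdifferentiableWithinAt_extChartAt_symm hu).hasMFDerivWithinAt).hasFDerivWithinAt

lemma exists_eventually_norm_mvfderiv_comp_symmL_le [FiniteDimensional ℝ E] [IsManifold I ∞ M]
    {f : M → G} {x : M} (hf : ∀ X : Π y : M, TangentSpace I y, CMDiffAt ∞ (T% X) x →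
      ∃ C : ℝ, ∀ᶠ y in 𝓝 x, ‖d% f y (X y)‖ ≤ C * ‖f y‖) :
    ∃ C : ℝ, ∀ᶠ y in 𝓝 x,
      ‖(d% f y).comp ((trivializationAt E (TangentSpace I) x).symmL ℝ y)‖ ≤ C * ‖f y‖ := by
  set T := trivializationAt E (TangentSpace I : M → Type _) x
  have hx : x ∈ T.baseSet := FiberBundle.mem_baseSet_trivializationAt' x
  let b := Module.finBasis ℝ E
  choose C hC using fun k => hf (T.localFrame b k) (contMDiffAt_localFrame_of_mem ∞ T b k hx)
  obtain ⟨K, -, hK⟩ := b.exists_opNorm_le (F := G)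
  obtain ⟨D, hD⟩ := Finite.exists_le C
  refine ⟨K * max D 0, ?_⟩
  filter_upwards [eventually_all.2 hC, T.open_baseSet.mem_nhds hx] with y hCy hy
  rw [mul_assoc]
  refine hK (by positivity) fun k => ?_
  calc ‖d% f y (T.symmL ℝ y (b k))‖ = ‖d% f y (T.localFrame b k y)‖ := by
        rw [T.localFrame_apply_of_mem_baseSet b hy, T.symmL_apply hy]; rfl
    _ ≤ C k * ‖f y‖ := hCy k
    _ ≤ max D 0 * ‖f y‖ := by gcongr; exact (hD k).trans (le_max_left _ _)

lemma eventually_eq_zero_of_norm_mvfderiv_le [FiniteDimensional ℝ E] [IsManifold I ∞ M]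
    {f : M → G} {x : M} (h0 : f x = 0) (hf : ∀ᶠ y in 𝓝 x, MDiffAt f y)
    (hbound : ∀ X : Π y : M, TangentSpace I y, CMDiffAt ∞ (T% X) x →
      ∃ C : ℝ, ∀ᶠ y in 𝓝 x, ‖d% f y (X y)‖ ≤ C * ‖f y‖) :
    ∀ᶠ y in 𝓝 x, f y = 0 := by
  have : IsManifold I 1 M := IsManifold.of_le (n := ∞) (by simp)
  set ψ := extChartAt I x
  obtain ⟨C, hC⟩ := exists_eventually_norm_mvfderiv_comp_symmL_le hbound
  have hψ : Tendsto ψ.symm (𝓝[range I] ψ x) (𝓝 x) :=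
    (map_extChartAt_symm_nhdsWithin_range x).le
  have htarget : ∀ᶠ u in 𝓝[range I] ψ x, u ∈ ψ.target := extChartAt_target_mem_nhdsWithin x
  obtain ⟨r, hr, hball⟩ := Metric.mem_nhdsWithin_iff.1
    (htarget.and (hψ.eventually (hf.and hC)))
  have hzero : ∀ u ∈ Metric.ball (ψ x) r ∩ range I, f (ψ.symm u) = 0 := fun u hu =>
    eq_zero_of_norm_hasFDerivWithinAt_le (f := f ∘ ψ.symm)
      ((convex_ball _ _).inter I.convex_range)
      (fun v hv => (hasFDerivWithinAt_comp_extChartAt_symm (hball hv).1 (hball hv).2.1).mono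
        inter_subset_right)
      (fun v hv => (hball hv).2.2)
      ⟨Metric.mem_ball_self hr, mem_range_self _⟩ hu (by simp [ψ, h0])
  have hψx : Tendsto ψ (𝓝 x) (𝓝 (ψ x)) := continuousAt_extChartAt x
  filter_upwards [hψx (Metric.ball_mem_nhds _ hr), extChartAt_source_mem_nhds (I := I) x]
    with y hy hys
  rw [← ψ.left_inv hys]
  exact hzero _ ⟨hy, extChartAt_target_subset_range x (ψ.map_source hys)⟩

end Manifold

end UniqueContinuation

/-! ### The spinor form -/

section SpinorForm

variable {m : ℕ}

lemma conj_paritySign {k : ℕ} (l : ℕ) (b : Fin k → Bool) :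
    (starRingEnd ℂ) (paritySign l b) = paritySign l b := by
  rw [paritySign, map_prod]
  exact Finset.prod_congr rfl fun i _ => by split_ifs <;> simp

lemma inner_pauli_left {a : ℕ} (ha : a ≤ m) (u v : Spinor m) :
    inner ℂ (pauli m a u) v = inner ℂ u (pauli m a v) := by
  let e : Equiv.Perm (Fin ((m + 1) / 2) → Bool) :=
    ⟨flipBit (a / 2), flipBit (a / 2), flip_flip _, flip_flip _⟩
  simp only [PiLp.inner_apply, pauli, LinearMap.coe_mk, AddHom.coe_mk, RCLike.inner_apply,
    map_mul, map_pow, conj_paritySign, Complex.conj_I]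
  rw [← Equiv.sum_comp e]
  refine Finset.sum_congr rfl fun b _ => ?_
  simp only [e, Equiv.coe_fn_mk, flip_flip]
  rcases Nat.even_or_odd' a with ⟨j, rfl | rfl⟩
  · rw [paritySign_flip_of_le (by omega), Nat.mul_mod_right]
    ring
  · rw [paritySign_flip_of_lt (by omega) (by omega), show (2 * j + 1) % 2 = 1 by omega]
    ring

lemma norm_pauli {a : ℕ} (ha : a ≤ m) (u : Spinor m) : ‖pauli m a u‖ = ‖u‖ := by
  have hsq : pauli m a (pauli m a u) = u := LinearMap.congr_fun (pauli_sq m ha) u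
  rw [@norm_eq_sqrt_re_inner ℂ, @norm_eq_sqrt_re_inner ℂ _ _ _ _ u, inner_pauli_left ha, hsq]

lemma norm_gamma (a : Fin (m + 1)) (u : Spinor m) : ‖gamma m a u‖ = ‖u‖ := by
  have h := norm_pauli (Nat.lt_succ_iff.1 a.2) u
  unfold gamma
  split_ifs
  · exact h
  · rw [LinearMap.smul_apply, norm_smul, Complex.norm_I, one_mul, h]

lemma inner_gamma_zero_left (u v : Spinor m) :
    inner ℂ (gamma m 0 u) v = inner ℂ u (gamma m 0 v) := by
  simpa [gamma] using inner_pauli_left (Nat.zero_le m) u v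

lemma inner_gamma_left {a : Fin (m + 1)} (ha : a ≠ 0) (u v : Spinor m) :
    inner ℂ (gamma m a u) v = -inner ℂ u (gamma m a v) := by
  simp [gamma, ha, inner_pauli_left (Nat.lt_succ_iff.1 a.2) u v, mul_comm]

lemma spinForm_add_left (u v w : Spinor m) :
    spinForm (u + v) w = spinForm u w + spinForm v w := by
  simp [spinForm]

lemma spinForm_add_right (u v w : Spinor m) :
    spinForm u (v + w) = spinForm u v + spinForm u w := by
  simp [spinForm]

lemma spinForm_real_smul_left (r : ℝ) (u v : Spinor m) :
    spinForm (r • u) v = r * spinForm u v := by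
  rw [spinForm, LinearMap.map_smul_of_tower, inner_smul_right_eq_smul, Complex.real_smul, spinForm]

lemma spinForm_real_smul_right (r : ℝ) (u v : Spinor m) :
    spinForm u (r • v) = r * spinForm u v := by
  rw [spinForm, inner_smul_left_eq_smul, Complex.real_smul, spinForm]

lemma spinForm_sum_left {κ : Type*} (s : Finset κ) (u : κ → Spinor m) (v : Spinor m) :
    spinForm (∑ k ∈ s, u k) v = ∑ k ∈ s, spinForm (u k) v := by
  simp [spinForm]

lemma spinForm_sum_right {κ : Type*} (s : Finset κ) (u : Spinor m) (v : κ → Spinor m) :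
    spinForm u (∑ k ∈ s, v k) = ∑ k ∈ s, spinForm u (v k) := by
  simp [spinForm]

lemma conj_spinForm (u v : Spinor m) : (starRingEnd ℂ) (spinForm u v) = spinForm v u := by
  rw [spinForm, spinForm, inner_conj_symm, inner_gamma_zero_left]

lemma spinForm_gamma_left (a : Fin (m + 1)) (u v : Spinor m) :
    spinForm (gamma m a u) v = spinForm u (gamma m a v) := by
  unfold spinForm
  by_cases ha : a = 0
  · rw [ha, inner_gamma_zero_left]
  · have hanti : gamma m a (gamma m 0 u) + gamma m 0 (gamma m a u) = 0 :=
      LinearMap.congr_fun (gamma_anticomm m ha) u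
    rw [inner_gamma_left ha, eq_neg_of_add_eq_zero_right hanti, inner_neg_right]

lemma spinForm_gamma_zero_self (u : Spinor m) : spinForm u (gamma m 0 u) = (‖u‖ ^ 2 : ℝ) := by
  rw [spinForm, inner_self_eq_norm_sq_to_K, norm_gamma]
  norm_cast

/-- The real bilinear form `(u, v) ↦ Re ⟨u, A v⟩` attached to an endomorphism `A` of the spinor
module, continuous so that `Re ⟨φ, A φ⟩` can be differentiated along a spinor field `φ`. -/
def reSpinForm (A : Module.End ℂ (Spinor m)) : Spinor m →L[ℝ] Spinor m →L[ℝ] ℝ :=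
  LinearMap.toContinuousBilinearMap <| LinearMap.mk₂ ℝ (fun u v => (spinForm u (A v)).re)
    (fun u v w => by simp [spinForm_add_left])
    (fun r u v => by simp [spinForm_real_smul_left])
    (fun u v w => by simp [spinForm_add_right])
    (fun r u v => by simp [spinForm_real_smul_right])

lemma reSpinForm_apply (A : Module.End ℂ (Spinor m)) (u v : Spinor m) :
    reSpinForm A u v = (spinForm u (A v)).re := rfl

end SpinorForm

/-! ### Clifford multiplication and the spin group -/

section CliffordMultiplication

variable {m : ℕ}

lemma gammaMap_apply (v : Fin (m + 1) → ℝ) (u : Spinor m) :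
    gammaMap m v u = ∑ a, v a • gamma m a u := by
  simp [gammaMap, Fintype.linearCombination_apply, LinearMap.sum_apply]

lemma gammaMap_single (a : Fin (m + 1)) : gammaMap m (Pi.single a 1) = gamma m a := by
  simp [gammaMap, Fintype.linearCombination_apply_single]

lemma spinRep_ι (v : Fin (m + 1) → ℝ) :
    spinRep m (CliffordAlgebra.ι (cliffordForm m) v) = gammaMap m v := by
  simp [spinRep]

lemma spinForm_gammaMap_left (v : Fin (m + 1) → ℝ) (u w : Spinor m) :
    spinForm (gammaMap m v u) w = spinForm u (gammaMap m v w) := by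
  simp only [gammaMap_apply, spinForm_sum_left, spinForm_sum_right, spinForm_real_smul_left,
    spinForm_real_smul_right, spinForm_gamma_left]

lemma spinForm_gammaMap_self_im (v : Fin (m + 1) → ℝ) (u : Spinor m) :
    (spinForm u (gammaMap m v u)).im = 0 := by
  rw [← Complex.conj_eq_iff_im, conj_spinForm, spinForm_gammaMap_left]

lemma spinForm_spinRep_left (x : Cl m) (u v : Spinor m) :
    spinForm (spinRep m x u) v = spinForm u (spinRep m (CliffordAlgebra.reverse x) v) := by
  induction x using CliffordAlgebra.induction generalizing u v with
  | algebraMap r =>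
    simp [Module.algebraMap_end_apply, spinForm_real_smul_left, spinForm_real_smul_right]
  | ι w => rw [CliffordAlgebra.reverse_ι, spinRep_ι, spinForm_gammaMap_left]
  | mul x y hx hy => simp [hx, hy]
  | add x y hx hy => simp [hx, hy, spinForm_add_left, spinForm_add_right]

lemma spinForm_spinRep_of_mem_spinGroup {s : Cl m} (hs : s ∈ spinGroup (cliffordForm m))
    (u v : Spinor m) : spinForm (spinRep m s u) (spinRep m s v) = spinForm u v := by
  have hstar : star s = CliffordAlgebra.reverse s := by
    rw [CliffordAlgebra.star_def, spinGroup.involute_eq hs]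
  rw [spinForm_spinRep_left, ← hstar, ← Module.End.mul_apply, ← map_mul,
    spinGroup.star_mul_self_of_mem hs, map_one, Module.End.one_apply]

end CliffordMultiplication

/-! ### The current of a spinor in Minkowski space -/

section Minkowski

variable {m : ℕ}

/-- The Minkowski inner product `η = diag(-1, 1, …, 1)` on `ℝ^(m+1)`, which is the polarization of
`-cliffordForm m`; it is the model of the metric in an orthonormal frame. -/
def minkowski (v w : Fin (m + 1) → ℝ) : ℝ := ∑ a, sgn a * v a * w a

lemma sgn_mul_self (a : Fin (m + 1)) : sgn a * sgn a = 1 := by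
  unfold sgn; split_ifs <;> norm_num

lemma cliffordForm_eq_neg_minkowski_self (v : Fin (m + 1) → ℝ) :
    cliffordForm m v = -minkowski v v := by
  simp [cliffordForm, QuadraticMap.weightedSumSquares_apply, minkowski, mul_assoc]

lemma minkowski_single_right (v : Fin (m + 1) → ℝ) (a : Fin (m + 1)) :
    minkowski v (Pi.single a 1) = sgn a * v a := by
  simp [minkowski, Pi.single_apply]

lemma minkowski_spatial_right (v : Fin (m + 1) → ℝ) :
    minkowski v (Function.update v 0 0) = v 0 ^ 2 + minkowski v v := by
  suffices v 0 ^ 2 + sgn (0 : Fin (m + 1)) * v 0 * v 0 = 0 by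
    simpa [minkowski, Fin.sum_univ_succ, ← add_assoc] using this
  rw [sgn, if_pos rfl]
  ring

lemma minkowski_spatial_self (v : Fin (m + 1) → ℝ) :
    minkowski (Function.update v 0 0) (Function.update v 0 0) =
      minkowski v (Function.update v 0 0) := by
  simp [minkowski, Fin.sum_univ_succ]

lemma inner_gammaMap_left {v : Fin (m + 1) → ℝ} (hv : v 0 = 0) (u w : Spinor m) :
    inner ℂ (gammaMap m v u) w = -inner ℂ u (gammaMap m v w) := by
  simp only [gammaMap_apply, sum_inner, inner_sum, ← Finset.sum_neg_distrib]
  refine Finset.sum_congr rfl fun a _ => ?_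
  by_cases ha : a = 0
  · simp [ha, hv]
  · rw [inner_smul_left_eq_smul, inner_smul_right_eq_smul, inner_gamma_left ha, smul_neg]

lemma norm_gammaMap_sq {v : Fin (m + 1) → ℝ} (hv : v 0 = 0) (u : Spinor m) :
    ‖gammaMap m v u‖ ^ 2 = minkowski v v * ‖u‖ ^ 2 := by
  have hsq : gammaMap m v (gammaMap m v u) = cliffordForm m v • u :=
    LinearMap.congr_fun (gammaMap_sq m v) u
  have hinner := inner_gammaMap_left hv u (gammaMap m v u)
  rw [hsq, inner_smul_right_eq_smul, cliffordForm_eq_neg_minkowski_self, neg_smul, neg_neg,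
    inner_self_eq_norm_sq_to_K, inner_self_eq_norm_sq_to_K, Complex.real_smul] at hinner
  apply Complex.ofReal_injective
  push_cast
  exact hinner

/-- The current `u ↦ (-ε_a ⟨u, γ_a u⟩)_a` of a spinor: the vector `j` of Minkowski space with
`η(j, v) = -⟨u, v · u⟩` for all `v`, i.e. the model of the Dirac current. -/
def diracCurrent (u : Spinor m) (a : Fin (m + 1)) : ℝ := -(sgn a * reSpinForm (gamma m a) u u)

lemma minkowski_diracCurrent_left (u : Spinor m) (v : Fin (m + 1) → ℝ) :
    minkowski (diracCurrent u) v = -(spinForm u (gammaMap m v u)).re := by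
  rw [gammaMap_apply, spinForm_sum_right, Complex.re_sum, ← Finset.sum_neg_distrib]
  refine Finset.sum_congr rfl fun a _ => ?_
  rw [spinForm_real_smul_right, Complex.re_ofReal_mul, diracCurrent, reSpinForm_apply]
  linear_combination -v a * (spinForm u (gamma m a u)).re * sgn_mul_self a

lemma diracCurrent_zero (u : Spinor m) : diracCurrent u 0 = ‖u‖ ^ 2 := by
  rw [diracCurrent, reSpinForm_apply, spinForm_gamma_zero_self, Complex.ofReal_re]
  simp [sgn]

lemma minkowski_diracCurrent_self_nonpos (u : Spinor m) :
    minkowski (diracCurrent u) (diracCurrent u) ≤ 0 := by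
  set v := diracCurrent u with hv
  set n := Function.update v 0 0
  have hn : n 0 = 0 := Function.update_self ..
  have hnv : minkowski n n = minkowski v n := minkowski_spatial_self v
  have hle : minkowski n n ≤ ‖gammaMap m n u‖ * ‖u‖ := calc
    minkowski n n = -(spinForm u (gammaMap m n u)).re := by
      rw [hnv, hv, minkowski_diracCurrent_left]
    _ ≤ ‖spinForm u (gammaMap m n u)‖ := (neg_le_abs _).trans (Complex.abs_re_le_norm _)
    _ ≤ ‖gammaMap m n u‖ * ‖gamma m 0 u‖ := norm_inner_le_norm _ _
    _ = ‖gammaMap m n u‖ * ‖u‖ := by rw [norm_gamma]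
  have hsq : ‖gammaMap m n u‖ ^ 2 = minkowski n n * ‖u‖ ^ 2 := norm_gammaMap_sq hn u
  have hnorm : ‖gammaMap m n u‖ ≤ ‖u‖ ^ 3 := by
    rcases (norm_nonneg (gammaMap m n u)).eq_or_lt with h | h
    · rw [← h]; positivity
    · refine le_of_mul_le_mul_left ?_ h
      calc ‖gammaMap m n u‖ * ‖gammaMap m n u‖ = minkowski n n * ‖u‖ ^ 2 := by rw [← hsq, sq]
        _ ≤ ‖gammaMap m n u‖ * ‖u‖ * ‖u‖ ^ 2 := by gcongr
        _ = ‖gammaMap m n u‖ * ‖u‖ ^ 3 := by ring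
  calc minkowski v v = minkowski n n - (‖u‖ ^ 2) ^ 2 := by
        rw [hnv, minkowski_spatial_right, hv, diracCurrent_zero]; ring
    _ ≤ ‖gammaMap m n u‖ * ‖u‖ - (‖u‖ ^ 2) ^ 2 := by gcongr
    _ ≤ ‖u‖ ^ 3 * ‖u‖ - (‖u‖ ^ 2) ^ 2 := by gcongr
    _ = 0 := by ring

end Minkowski

/-! ### Orthonormal frames and the Dirac current -/

section OrthonormalFrame

variable {m : ℕ} {M : Type*} [TopologicalSpace M]
  [ChartedSpace (EuclideanSpace ℝ (Fin (m + 1))) M] [IsManifold (𝓡 (m + 1)) ∞ M]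
  {g : LorentzianMetric m M} {x : M} {e : Fin (m + 1) → TangentSpace (𝓡 (m + 1)) x}

/-- The vectors `e_0, …, e_m` of `T_xM` are orthonormal for the Lorentzian metric, with `e_0`
time-like. -/
def IsOrthonormalFrame (g : LorentzianMetric m M) {x : M}
    (e : Fin (m + 1) → TangentSpace (𝓡 (m + 1)) x) : Prop :=
  ∀ a c, g.val x (e a) (e c) = if a = c then sgn a else 0

namespace IsOrthonormalFrame

lemma components_sum_smul (he : IsOrthonormalFrame g e) (v : Fin (m + 1) → ℝ) :
    components g e (∑ a, v a • e a) = v := by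
  funext c
  simp only [components, map_sum, map_smul, sum_apply, smul_apply, smul_eq_mul, he _ c, mul_ite,
    mul_zero, Finset.sum_ite_eq', Finset.mem_univ, if_true]
  linear_combination v c * sgn_mul_self c

lemma components_apply (he : IsOrthonormalFrame g e) (c : Fin (m + 1)) :
    components g e (e c) = Pi.single c 1 := by
  simpa [Pi.single_apply] using he.components_sum_smul (Pi.single c 1)

lemma linearIndependent (he : IsOrthonormalFrame g e) : LinearIndependent ℝ e := by
  refine Fintype.linearIndependent_iff.2 fun v hv => congrFun ?_
  rw [← he.components_sum_smul v, hv]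
  funext a
  simp [components]

lemma sum_components_smul (he : IsOrthonormalFrame g e) (X : TangentSpace (𝓡 (m + 1)) x) :
    ∑ a, components g e X a • e a = X := by
  have : FiniteDimensional ℝ (TangentSpace (𝓡 (m + 1)) x) :=
    inferInstanceAs (FiniteDimensional ℝ (EuclideanSpace ℝ (Fin (m + 1))))
  have hcard : Fintype.card (Fin (m + 1)) = Module.finrank ℝ (TangentSpace (𝓡 (m + 1)) x) :=
    (Fintype.card_fin _).trans (finrank_euclideanSpace_fin (𝕜 := ℝ) (n := m + 1)).symm
  have hX : X ∈ Submodule.span ℝ (Set.range e) := by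
    rw [he.linearIndependent.span_eq_top_of_card_eq_finrank' hcard]
    trivial
  obtain ⟨v, rfl⟩ := (Submodule.mem_span_range_iff_exists_fun ℝ).1 hX
  rw [he.components_sum_smul]

lemma metric_eq_minkowski (he : IsOrthonormalFrame g e) (X Y : TangentSpace (𝓡 (m + 1)) x) :
    g.val x X Y = minkowski (components g e X) (components g e Y) := by
  conv_lhs => rw [← he.sum_components_smul X]
  simp only [map_sum, map_smul, sum_apply, smul_apply, smul_eq_mul, minkowski]
  refine Finset.sum_congr rfl fun a _ => ?_
  rw [show components g e Y a = sgn a * g.val x (e a) Y by rw [components, g.symm]]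
  linear_combination -components g e X a * g.val x (e a) Y * sgn_mul_self a

lemma eq_zero_of_metric_eq_zero (he : IsOrthonormalFrame g e) {X : TangentSpace (𝓡 (m + 1)) x}
    (h : ∀ a, g.val x X (e a) = 0) : X = 0 := by
  rw [← he.sum_components_smul X]
  simp [components, h]

end IsOrthonormalFrame

lemma SpinStructure.isOrthonormalFrame {ι : Type*} (S : SpinStructure g ι) {i : ι}
    (hx : x ∈ S.U i) : IsOrthonormalFrame g fun a => S.frame i a x :=
  S.orthonormal i x hx

end OrthonormalFrame

section DiracCurrent

variable {m : ℕ} {M : Type*} [TopologicalSpace M]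
  [ChartedSpace (EuclideanSpace ℝ (Fin (m + 1))) M] [IsManifold (𝓡 (m + 1)) ∞ M]
  {g : LorentzianMetric m M} {ι : Type*} {S : SpinStructure g ι}

lemma SpinStructure.U_mem_nhds (S : SpinStructure g ι) {i : ι} {x : M} (hx : x ∈ S.U i) :
    S.U i ∈ nhds x :=
  (S.isOpen_U i).mem_nhds hx

lemma SpinStructure.contMDiffAt_frame (S : SpinStructure g ι) {i : ι} {x : M} (hx : x ∈ S.U i)
    (a : Fin (m + 1)) : ContMDiffAt (𝓡 (m + 1)) (𝓡 (m + 1)).tangent ∞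
      (fun y => (⟨y, S.frame i a y⟩ : TangentBundle (𝓡 (m + 1)) M)) x :=
  (S.contMDiffOn_frame i a).contMDiffAt (S.U_mem_nhds hx)

namespace SpinorField

lemma contMDiffAt (φ : SpinorField S) {i : ι} {x : M} (hx : x ∈ S.U i) :
    ContMDiffAt (𝓡 (m + 1)) 𝓘(ℝ, Spinor m) ∞ (φ.toFun i) x :=
  (φ.contMDiffOn i).contMDiffAt (S.U_mem_nhds hx)

lemma clifford_eq_gammaMap (φ : SpinorField S) (i : ι) (x : M) (X : TangentSpace (𝓡 (m + 1)) x) :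
    φ.clifford i x X = gammaMap m (components g (fun a => S.frame i a x) X) (φ.toFun i x) := by
  rw [clifford, spinRep_ι]

lemma clifford_compatible (φ : SpinorField S) {i j : ι} {x : M} (hx : x ∈ S.U i ∩ S.U j)
    (X : TangentSpace (𝓡 (m + 1)) x) :
    φ.clifford i x X = spinRep m (S.h i j x) (φ.clifford j x X) := by
  rw [clifford, clifford, φ.compatible i j x hx, ← Module.End.mul_apply, ← map_mul,
    ← S.covers i j x hx X, map_mul, Module.End.mul_apply]

lemma spinForm_clifford_compatible (φ : SpinorField S) {i j : ι} {x : M}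
    (hx : x ∈ S.U i ∩ S.U j) (X : TangentSpace (𝓡 (m + 1)) x) :
    spinForm (φ.toFun i x) (φ.clifford i x X) = spinForm (φ.toFun j x) (φ.clifford j x X) := by
  rw [φ.compatible i j x hx, φ.clifford_compatible hx,
    spinForm_spinRep_of_mem_spinGroup (S.mem_spin i j x hx)]

lemma metric_eq_spinForm_clifford_iff (φ : SpinorField S) (i : ι) (x : M)
    (Y X : TangentSpace (𝓡 (m + 1)) x) :
    ((g.val x Y X : ℝ) : ℂ) = Complex.I ^ (1 + 1) * spinForm (φ.toFun i x) (φ.clifford i x X) ↔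
      g.val x Y X =
        minkowski (diracCurrent (φ.toFun i x)) (components g (fun a => S.frame i a x) X) := by
  rw [one_add_one_eq_two, Complex.I_sq, neg_one_mul, clifford_eq_gammaMap,
    minkowski_diracCurrent_left, Complex.ext_iff, Complex.ofReal_re, Complex.ofReal_im,
    Complex.neg_im, spinForm_gammaMap_self_im, Complex.neg_re]
  simp

variable {φ : SpinorField S} {V : ∀ x : M, TangentSpace (𝓡 (m + 1)) x} {i : ι} {x : M}

lemma IsDiracCurrent.metric_eq (hV : φ.IsDiracCurrent V) (hx : x ∈ S.U i)
    (X : TangentSpace (𝓡 (m + 1)) x) :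
    g.val x (V x) X =
      minkowski (diracCurrent (φ.toFun i x)) (components g (fun a => S.frame i a x) X) :=
  (φ.metric_eq_spinForm_clifford_iff i x _ _).1 (hV i x hx X)

lemma IsDiracCurrent.components_eq (hV : φ.IsDiracCurrent V) (hx : x ∈ S.U i) :
    components g (fun a => S.frame i a x) (V x) = diracCurrent (φ.toFun i x) := by
  funext a
  rw [components, hV.metric_eq hx, (S.isOrthonormalFrame hx).components_apply,
    minkowski_single_right, ← mul_assoc, sgn_mul_self, one_mul]

lemma IsDiracCurrent.eq_sum (hV : φ.IsDiracCurrent V) (hx : x ∈ S.U i) :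
    V x = ∑ a, diracCurrent (φ.toFun i x) a • S.frame i a x := by
  rw [← hV.components_eq hx, (S.isOrthonormalFrame hx).sum_components_smul]

lemma existsUnique_isDiracCurrent (φ : SpinorField S) :
    ∃! V : ∀ x : M, TangentSpace (𝓡 (m + 1)) x, φ.IsDiracCurrent V := by
  choose k hk using S.exists_mem_U
  refine ⟨fun x => ∑ a, diracCurrent (φ.toFun (k x) x) a • S.frame (k x) a x,
    fun i x hx X => ?_, fun W hW => funext fun x => hW.eq_sum (hk x)⟩
  have he := S.isOrthonormalFrame (hk x)
  rw [φ.spinForm_clifford_compatible ⟨hx, hk x⟩, φ.metric_eq_spinForm_clifford_iff,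
    he.metric_eq_minkowski, he.components_sum_smul]

lemma IsDiracCurrent.metric_self_nonpos (hV : φ.IsDiracCurrent V) (x : M) :
    g.val x (V x) (V x) ≤ 0 := by
  obtain ⟨i, hx⟩ := S.exists_mem_U x
  rw [hV.metric_eq hx, hV.components_eq hx]
  exact minkowski_diracCurrent_self_nonpos _

lemma IsDiracCurrent.ne_zero_of_ne_zero (hV : φ.IsDiracCurrent V) (hx : x ∈ S.U i)
    (h0 : φ.toFun i x ≠ 0) : V x ≠ 0 := by
  intro hVx
  have hnorm : components g (fun a => S.frame i a x) (V x) 0 = ‖φ.toFun i x‖ ^ 2 := by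
    rw [hV.components_eq hx, diracCurrent_zero]
  refine pow_ne_zero 2 (norm_ne_zero_iff.2 h0) ?_
  simp [← hnorm, components, hVx]

lemma IsDiracCurrent.contMDiff (hV : φ.IsDiracCurrent V) :
    ContMDiff (𝓡 (m + 1)) (𝓡 (m + 1)).tangent ∞
      (fun x => (⟨x, V x⟩ : TangentBundle (𝓡 (m + 1)) M)) := by
  intro x
  obtain ⟨i, hx⟩ := S.exists_mem_U x
  have hsum : ContMDiffAt (𝓡 (m + 1)) (𝓡 (m + 1)).tangent ∞
      (fun y => (⟨y, ∑ a, diracCurrent (φ.toFun i y) a • S.frame i a y⟩ :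
        TangentBundle (𝓡 (m + 1)) M)) x := by
    refine ContMDiffAt.sum_section fun a _ => ContMDiffAt.smul_section
      (f := fun y => diracCurrent (φ.toFun i y) a) ?_ (S.contMDiffAt_frame hx a)
    have hcurrent : ContDiff ℝ ∞ fun u : Spinor m => diracCurrent u a :=
      (contDiff_const.mul ((reSpinForm (gamma m a)).contDiff.clm_apply contDiff_id)).neg
    exact hcurrent.contMDiff.contMDiffAt.comp x (φ.contMDiffAt hx)
  refine hsum.congr_of_eventuallyEq ?_
  filter_upwards [S.U_mem_nhds hx] with y hy
  rw [hV.eq_sum hy]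

end SpinorField

end DiracCurrent

/-! ### The spin connection -/

section SpinConnection

variable {m : ℕ} {θ : Fin (m + 1) → Fin (m + 1) → ℝ}

/-- The endomorphism `(1/4) ∑ θ_{ac} γ_a γ_c` of the spinor module by which the covariant
derivative of spinors differs from the ordinary one. -/
def spinConnection (θ : Fin (m + 1) → Fin (m + 1) → ℝ) : Module.End ℂ (Spinor m) :=
  (1 / 4 : ℝ) • ∑ a, ∑ c, θ a c • (gamma m a * gamma m c)

lemma spinConnection_apply (θ : Fin (m + 1) → Fin (m + 1) → ℝ) (u : Spinor m) :
    spinConnection θ u = (1 / 4 : ℝ) • ∑ a, ∑ c, θ a c • gamma m a (gamma m c u) := by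
  simp [spinConnection, LinearMap.sum_apply]

lemma norm_spinConnection_apply_le (θ : Fin (m + 1) → Fin (m + 1) → ℝ) (u : Spinor m) :
    ‖spinConnection θ u‖ ≤ (1 / 4) * (m + 1) ^ 2 * ‖θ‖ * ‖u‖ := by
  have hterm (a c : Fin (m + 1)) : ‖θ a c • gamma m a (gamma m c u)‖ ≤ ‖θ‖ * ‖u‖ := by
    rw [norm_smul, norm_gamma, norm_gamma]
    gcongr
    exact (norm_le_pi_norm (θ a) c).trans (norm_le_pi_norm θ a)
  calc ‖spinConnection θ u‖ = 1 / 4 * ‖∑ a, ∑ c, θ a c • gamma m a (gamma m c u)‖ := by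
        rw [spinConnection_apply, norm_smul, Real.norm_of_nonneg (by norm_num)]
    _ ≤ 1 / 4 * ∑ _a : Fin (m + 1), ∑ _c : Fin (m + 1), ‖θ‖ * ‖u‖ := by
        gcongr
        exact norm_sum_le_of_le _ fun a _ => norm_sum_le_of_le _ fun c _ => hterm a c
    _ = (1 / 4) * (m + 1) ^ 2 * ‖θ‖ * ‖u‖ := by
        simp only [Finset.sum_const, Finset.card_univ, Fintype.card_fin, nsmul_eq_mul,
          Nat.cast_add, Nat.cast_one]
        ring

lemma spinForm_spinConnection_left (hθ : ∀ a c, θ a c = -θ c a) (u v : Spinor m) :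
    spinForm (spinConnection θ u) v = -spinForm u (spinConnection θ v) := by
  simp only [spinConnection_apply, spinForm_real_smul_left, spinForm_real_smul_right,
    spinForm_sum_left, spinForm_sum_right, spinForm_gamma_left]
  rw [Finset.sum_comm, ← mul_neg]
  simp only [← Finset.sum_neg_distrib]
  refine congrArg _ (Finset.sum_congr rfl fun a _ => Finset.sum_congr rfl fun c _ => ?_)
  rw [hθ c a, Complex.ofReal_neg, neg_mul]

lemma gamma_mul_add_gamma_mul (a c : Fin (m + 1)) :
    gamma m a * gamma m c + gamma m c * gamma m a =
      (if a = c then -2 * sgn a else 0 : ℝ) • (1 : Module.End ℂ (Spinor m)) := by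
  split_ifs with h
  · rw [h, gamma_sq, Algebra.algebraMap_eq_smul_one, ← add_smul]
    congr 1
    ring
  · rw [gamma_anticomm m h, zero_smul]

lemma gamma_mul_gamma_mul_sub (a d c : Fin (m + 1)) :
    gamma m a * gamma m d * gamma m c - gamma m c * (gamma m a * gamma m d) =
      (if c = d then -2 * sgn c else 0 : ℝ) • gamma m a -
        (if c = a then -2 * sgn c else 0 : ℝ) • gamma m d := by
  have ha := congrArg (· * gamma m d) (gamma_mul_add_gamma_mul c a)
  have hd := congrArg (gamma m a * ·) (gamma_mul_add_gamma_mul c d)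
  simp only [smul_mul_assoc, one_mul, mul_smul_comm, mul_one] at ha hd
  rw [← ha, ← hd]
  noncomm_ring

lemma spinConnection_mul_gamma_sub (hθ : ∀ a c, θ a c = -θ c a) (c : Fin (m + 1)) :
    spinConnection θ * gamma m c - gamma m c * spinConnection θ =
      gammaMap m fun d => sgn c * θ c d := by
  have hcomm : spinConnection θ * gamma m c - gamma m c * spinConnection θ =
      (1 / 4 : ℝ) • ∑ a, ∑ d, θ a d •
        (gamma m a * gamma m d * gamma m c - gamma m c * (gamma m a * gamma m d)) := by
    simp only [spinConnection, mul_smul_comm, smul_mul_assoc, Finset.mul_sum, Finset.sum_mul,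
      smul_sub, Finset.sum_sub_distrib]
  have hleft : ∑ a, ∑ d, θ a d • (if c = d then -2 * sgn c else 0 : ℝ) • gamma m a =
      ∑ d, (2 * sgn c * θ c d) • gamma m d := by
    simp only [ite_smul, zero_smul, smul_ite, smul_zero, Finset.sum_ite_eq, Finset.mem_univ,
      if_true, smul_smul]
    congr! 2 with d
    rw [hθ d c]
    ring
  have hright : ∑ a, ∑ d, θ a d • (if c = a then -2 * sgn c else 0 : ℝ) • gamma m d =
      ∑ d, (-(2 * sgn c * θ c d)) • gamma m d := by
    rw [Finset.sum_comm]
    simp only [ite_smul, zero_smul, smul_ite, smul_zero, Finset.sum_ite_eq, Finset.mem_univ,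
      if_true, smul_smul]
    congr! 2 with d
    ring
  simp only [hcomm, gamma_mul_gamma_mul_sub, smul_sub, Finset.sum_sub_distrib]
  rw [← smul_sub, hleft, hright, ← Finset.sum_sub_distrib, Finset.smul_sum, gammaMap,
    Fintype.linearCombination_apply]
  congr! 1 with d
  rw [← sub_smul, smul_smul]
  congr 1
  ring

lemma spinForm_spinConnection_gamma (hθ : ∀ a c, θ a c = -θ c a) (c : Fin (m + 1))
    (u v : Spinor m) :
    spinForm (spinConnection θ u) (gamma m c v) + spinForm u (gamma m c (spinConnection θ v)) =
      -spinForm u (gammaMap m (fun d => sgn c * θ c d) v) := by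
  have hcomm : spinConnection θ (gamma m c v) =
      gamma m c (spinConnection θ v) + gammaMap m (fun d => sgn c * θ c d) v :=
    eq_add_of_sub_eq' (LinearMap.congr_fun (spinConnection_mul_gamma_sub hθ c) v)
  rw [spinForm_spinConnection_left hθ, hcomm, spinForm_add_right]
  ring

end SpinConnection

section MFDeriv

variable {𝕜 E H M F F' G : Type*} [NontriviallyNormedField 𝕜] [NormedAddCommGroup E]
  [NormedSpace 𝕜 E] [TopologicalSpace H] {I : ModelWithCorners 𝕜 E H} [TopologicalSpace M]
  [ChartedSpace H M] [NormedAddCommGroup F] [NormedSpace 𝕜 F] [NormedAddCommGroup F']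
  [NormedSpace 𝕜 F'] [NormedAddCommGroup G] [NormedSpace 𝕜 G]

lemma mvfderiv_congr_of_eventuallyEq {f f' : M → F} {x : M} (h : f =ᶠ[nhds x] f')
    (X : TangentSpace I x) : d% f x X = d% f' x X :=
  DFunLike.congr_fun (h.mfderiv_eq (I := I) (I' := 𝓘(𝕜, F))) X

lemma mvfderiv_clm_apply₂ (B : F →L[𝕜] F' →L[𝕜] G) {f : M → F} {h : M → F'} {x : M}
    (hf : MDiffAt f x) (hh : MDiffAt h x) (X : TangentSpace I x) :
    d% (fun y => B (f y) (h y)) x X = B (d% f x X) (h x) + B (f x) (d% h x X) := by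
  have hderiv : HasMFDerivAt I 𝓘(𝕜, G) (fun y => B (f y) (h y)) x
      (B (f x) ∘L mvfderiv I h x + B.flip (h x) ∘L mvfderiv I f x) :=
    ⟨(B.continuous.continuousAt.comp hf.continuousAt).clm_apply hh.continuousAt, by
      convert! B.hasFDerivWithinAt_of_bilinear hf.hasMFDerivAt.2 hh.hasMFDerivAt.2
      simp only [writtenInExtChartAt, mfld_simps]
      rfl⟩
  exact (DFunLike.congr_fun hderiv.mfderiv X).trans (add_comm _ _)

end MFDeriv

section ParallelCurrent

variable {m : ℕ} {M : Type*} [TopologicalSpace M]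
  [ChartedSpace (EuclideanSpace ℝ (Fin (m + 1))) M] [IsManifold (𝓡 (m + 1)) ∞ M]
  {g : LorentzianMetric m M} {nabla : Connection m M} {ι : Type*}

/-- The connection `∇` is metric (`∇ g = 0`); it may have torsion. -/
def IsMetric (g : LorentzianMetric m M) (nabla : Connection m M) : Prop :=
  ∀ (Y Z : ∀ x : M, TangentSpace (𝓡 (m + 1)) x) (x : M),
    MDifferentiableAt (𝓡 (m + 1)) (𝓡 (m + 1)).tangent
      (fun y => (⟨y, Y y⟩ : TangentBundle (𝓡 (m + 1)) M)) x →
    MDifferentiableAt (𝓡 (m + 1)) (𝓡 (m + 1)).tangent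
      (fun y => (⟨y, Z y⟩ : TangentBundle (𝓡 (m + 1)) M)) x →
    ∀ X : TangentSpace (𝓡 (m + 1)) x,
      mvfderiv (𝓡 (m + 1)) (fun y => g.val y (Y y) (Z y)) x X =
        g.val x (nabla Y x X) (Z x) + g.val x (Y x) (nabla Z x X)

namespace SpinStructure

variable (S : SpinStructure g ι) {i : ι} {x : M}

lemma mdifferentiableAt_frame (hx : x ∈ S.U i) (a : Fin (m + 1)) :
    MDifferentiableAt (𝓡 (m + 1)) (𝓡 (m + 1)).tangent
      (fun y => (⟨y, S.frame i a y⟩ : TangentBundle (𝓡 (m + 1)) M)) x :=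
  (S.contMDiffAt_frame hx a).mdifferentiableAt (by simp)

/-- The connection form `ε_a ε_c g(∇_X e_a, e_c)` of a connection in the frame `i`. -/
def connectionForm (nabla : Connection m M) (i : ι) (x : M) (X : TangentSpace (𝓡 (m + 1)) x)
    (a c : Fin (m + 1)) : ℝ :=
  sgn a * sgn c * g.val x (nabla (S.frame i a) x X) (S.frame i c x)

lemma components_nabla_frame (nabla : Connection m M) (i : ι) (x : M)
    (X : TangentSpace (𝓡 (m + 1)) x) (c : Fin (m + 1)) :
    components g (fun a => S.frame i a x) (nabla (S.frame i c) x X) =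
      fun d => sgn c * S.connectionForm nabla i x X c d := by
  funext d
  rw [components, connectionForm]
  linear_combination -sgn d * g.val x (nabla (S.frame i c) x X) (S.frame i d x) * sgn_mul_self c

lemma metric_nabla_frame_antisymm (hnabla : IsMetric g nabla) (hx : x ∈ S.U i)
    (X : TangentSpace (𝓡 (m + 1)) x) (a c : Fin (m + 1)) :
    g.val x (nabla (S.frame i a) x X) (S.frame i c x) =
      -g.val x (nabla (S.frame i c) x X) (S.frame i a x) := by
  have hmetric :=
    hnabla _ _ x (S.mdifferentiableAt_frame hx a) (S.mdifferentiableAt_frame hx c) X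
  have hconst : (fun y => g.val y (S.frame i a y) (S.frame i c y)) =ᶠ[nhds x]
      fun _ => if a = c then sgn a else 0 :=
    Filter.eventually_of_mem (S.U_mem_nhds hx) fun y hy => S.orthonormal i y hy a c
  rw [mvfderiv_congr_of_eventuallyEq hconst, mvfderiv_const] at hmetric
  rw [g.symm x (nabla (S.frame i c) x X)]
  exact eq_neg_of_add_eq_zero_left hmetric.symm

lemma connectionForm_antisymm (hnabla : IsMetric g nabla) (hx : x ∈ S.U i)
    (X : TangentSpace (𝓡 (m + 1)) x) (a c : Fin (m + 1)) :
    S.connectionForm nabla i x X a c = -S.connectionForm nabla i x X c a := by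
  rw [connectionForm, connectionForm, S.metric_nabla_frame_antisymm hnabla hx]
  ring

end SpinStructure

namespace SpinorField

variable {S : SpinStructure g ι} {φ : SpinorField S} {i : ι} {x : M}

lemma mdifferentiableAt (φ : SpinorField S) (hx : x ∈ S.U i) :
    MDifferentiableAt (𝓡 (m + 1)) 𝓘(ℝ, Spinor m) (φ.toFun i) x :=
  (φ.contMDiffAt hx).mdifferentiableAt (by simp)

lemma IsParallel.mvfderiv_eq (hφ : φ.IsParallel nabla) (hx : x ∈ S.U i)
    (X : TangentSpace (𝓡 (m + 1)) x) :
    mvfderiv (𝓡 (m + 1)) (φ.toFun i) x X =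
      -spinConnection (S.connectionForm nabla i x X) (φ.toFun i x) := by
  rw [spinConnection_apply]
  exact eq_neg_of_add_eq_zero_left (hφ i x hx X)

variable {V : ∀ x : M, TangentSpace (𝓡 (m + 1)) x}

lemma IsDiracCurrent.metric_frame (hV : φ.IsDiracCurrent V) (hx : x ∈ S.U i) (c : Fin (m + 1)) :
    g.val x (V x) (S.frame i c x) = -reSpinForm (gamma m c) (φ.toFun i x) (φ.toFun i x) := by
  rw [hV.metric_eq hx, (S.isOrthonormalFrame hx).components_apply, minkowski_diracCurrent_left,
    gammaMap_single, reSpinForm_apply]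

lemma IsDiracCurrent.mvfderiv_metric_frame (hnabla : IsMetric g nabla) (hφ : φ.IsParallel nabla)
    (hV : φ.IsDiracCurrent V) (hx : x ∈ S.U i) (c : Fin (m + 1))
    (X : TangentSpace (𝓡 (m + 1)) x) :
    mvfderiv (𝓡 (m + 1)) (fun y => g.val y (V y) (S.frame i c y)) x X =
      g.val x (V x) (nabla (S.frame i c) x X) := by
  set B := reSpinForm (gamma m c)
  set u := φ.toFun i x
  set A := spinConnection (S.connectionForm nabla i x X)
  have hloc : (fun y => g.val y (V y) (S.frame i c y)) =ᶠ[nhds x]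
      fun y => -B (φ.toFun i y) (φ.toFun i y) :=
    Filter.eventually_of_mem (S.U_mem_nhds hx) fun y hy => hV.metric_frame hy c
  calc mvfderiv (𝓡 (m + 1)) (fun y => g.val y (V y) (S.frame i c y)) x X
      = mvfderiv (𝓡 (m + 1)) (fun y => (-B) (φ.toFun i y) (φ.toFun i y)) x X :=
        mvfderiv_congr_of_eventuallyEq hloc X
    _ = (-B) (-A u) u + (-B) u (-A u) := by
        rw [mvfderiv_clm_apply₂ (-B) (φ.mdifferentiableAt hx) (φ.mdifferentiableAt hx),
          hφ.mvfderiv_eq hx]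
    _ = (spinForm (A u) (gamma m c u) + spinForm u (gamma m c (A u))).re := by
        simp only [neg_apply, map_neg, neg_neg, B, reSpinForm_apply,
          Complex.add_re]
    _ = g.val x (V x) (nabla (S.frame i c) x X) := by
        rw [spinForm_spinConnection_gamma (S.connectionForm_antisymm hnabla hx X), hV.metric_eq hx,
          minkowski_diracCurrent_left, S.components_nabla_frame, Complex.neg_re]

lemma IsDiracCurrent.nabla_eq_zero (hnabla : IsMetric g nabla) (hφ : φ.IsParallel nabla)
    (hV : φ.IsDiracCurrent V) (x : M) (X : TangentSpace (𝓡 (m + 1)) x) : nabla V x X = 0 := by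
  obtain ⟨i, hx⟩ := S.exists_mem_U x
  refine (S.isOrthonormalFrame hx).eq_zero_of_metric_eq_zero fun c => ?_
  have hmetric := hnabla V (S.frame i c) x (hV.contMDiff.contMDiffAt.mdifferentiableAt (by simp))
    (S.mdifferentiableAt_frame hx c) X
  rw [hV.mvfderiv_metric_frame hnabla hφ hx] at hmetric
  exact right_eq_add.1 hmetric

end SpinorField

end ParallelCurrent

section NowhereVanishing

open Filter Topology

variable {m : ℕ} {M : Type*} [TopologicalSpace M]
  [ChartedSpace (EuclideanSpace ℝ (Fin (m + 1))) M] [IsManifold (𝓡 (m + 1)) ∞ M]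
  {g : LorentzianMetric m M} {nabla : Connection m M} {ι : Type*}

lemma continuousAt_metric {Y Z : ∀ x : M, TangentSpace (𝓡 (m + 1)) x} {x : M}
    (hY : ContMDiffAt (𝓡 (m + 1)) (𝓡 (m + 1)).tangent 0
      (fun y => (⟨y, Y y⟩ : TangentBundle (𝓡 (m + 1)) M)) x)
    (hZ : ContMDiffAt (𝓡 (m + 1)) (𝓡 (m + 1)).tangent 0
      (fun y => (⟨y, Z y⟩ : TangentBundle (𝓡 (m + 1)) M)) x) :
    ContinuousAt (fun y => g.val y (Y y) (Z y)) x := by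
  have h : ContMDiffAt (𝓡 (m + 1)) ((𝓡 (m + 1)).prod 𝓘(ℝ, ℝ)) 0
      (fun y => (⟨y, g.val y (Y y) (Z y)⟩ : Bundle.TotalSpace ℝ (Bundle.Trivial M ℝ))) x :=
    ContMDiffAt.clm_bundle_apply₂ (F₁ := EuclideanSpace ℝ (Fin (m + 1)))
      (F₂ := EuclideanSpace ℝ (Fin (m + 1))) ((g.contMDiff x).of_le (by simp)) hY hZ
  exact (Bundle.contMDiffAt_totalSpace.1 h).2.continuousAt

namespace SpinStructure

variable (S : SpinStructure g ι) {i : ι} {x : M}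

/-- The connection has continuous coefficients `g(∇_{e_b} e_a, e_c)` in the local frames of the
spin structure. -/
def HasContinuousCoefficients (nabla : Connection m M) : Prop :=
  ∀ (i : ι) (a b c : Fin (m + 1)), ContinuousOn
    (fun x => g.val x (nabla (S.frame i a) x (S.frame i b x)) (S.frame i c x)) (S.U i)

variable {S}

lemma HasContinuousCoefficients.continuousAt_connectionForm
    (hcont : S.HasContinuousCoefficients nabla) (hx : x ∈ S.U i)
    {X : ∀ y : M, TangentSpace (𝓡 (m + 1)) y}
    (hX : ContMDiffAt (𝓡 (m + 1)) (𝓡 (m + 1)).tangent 0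
      (fun y => (⟨y, X y⟩ : TangentBundle (𝓡 (m + 1)) M)) x) :
    ContinuousAt (fun y => S.connectionForm nabla i y (X y)) x := by
  refine continuousAt_pi.2 fun a => continuousAt_pi.2 fun c => ?_
  have hcomp (b : Fin (m + 1)) :
      ContinuousAt (fun y => components g (fun d => S.frame i d y) (X y) b) x :=
    (continuousAt_metric hX ((S.contMDiffAt_frame hx b).of_le (by simp))).const_mul (sgn b)
  have hsum : ContinuousAt (fun y => sgn a * sgn c *
      ∑ b, components g (fun d => S.frame i d y) (X y) b *
        g.val y (nabla (S.frame i a) y (S.frame i b y)) (S.frame i c y)) x :=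
    (tendsto_finsetSum _ fun b _ =>
      (hcomp b).mul ((hcont i a b c).continuousAt (S.U_mem_nhds hx))).const_mul _
  refine hsum.congr (eventually_of_mem (S.U_mem_nhds hx) fun y hy => ?_)
  simp only [connectionForm]
  conv_rhs => rw [← (S.isOrthonormalFrame hy).sum_components_smul (X y)]
  simp only [map_sum, map_smul, sum_apply, smul_apply, smul_eq_mul]

end SpinStructure

namespace SpinorField

variable {S : SpinStructure g ι} {φ : SpinorField S} {i j : ι} {x : M}

lemma eq_zero_of_eq_zero (φ : SpinorField S) (hi : x ∈ S.U i) (hj : x ∈ S.U j)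
    (h0 : φ.toFun j x = 0) : φ.toFun i x = 0 := by
  rw [φ.compatible i j x ⟨hi, hj⟩, h0, map_zero]

lemma IsParallel.eventually_eq_zero (hcont : S.HasContinuousCoefficients nabla)
    (hφ : φ.IsParallel nabla) (hx : x ∈ S.U i) (h0 : φ.toFun i x = 0) :
    ∀ᶠ y in 𝓝 x, φ.toFun i y = 0 := by
  refine eventually_eq_zero_of_norm_mvfderiv_le h0
    (eventually_of_mem (S.U_mem_nhds hx) fun y hy => φ.mdifferentiableAt hy) fun X hX => ?_
  have hnorm : ∀ᶠ y in 𝓝 x, ‖S.connectionForm nabla i y (X y)‖ <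
      ‖S.connectionForm nabla i x (X x)‖ + 1 :=
    (hcont.continuousAt_connectionForm hx (hX.of_le (by simp))).norm.eventually_lt
      continuousAt_const (lt_add_one _)
  refine ⟨(1 / 4) * (m + 1) ^ 2 * (‖S.connectionForm nabla i x (X x)‖ + 1), ?_⟩
  filter_upwards [hnorm, S.U_mem_nhds hx] with y hy hyU
  rw [hφ.mvfderiv_eq hyU, norm_neg]
  refine (norm_spinConnection_apply_le _ _).trans ?_
  gcongr

lemma IsParallel.ne_zero [ConnectedSpace M] (hcont : S.HasContinuousCoefficients nabla)
    (hφ : φ.IsParallel nabla) (hφ0 : φ.IsNontrivial) (hx : x ∈ S.U i) : φ.toFun i x ≠ 0 := by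
  set Z : Set M := {y | ∃ j, y ∈ S.U j ∧ φ.toFun j y = 0}
  have hopen : IsOpen Z := by
    refine isOpen_iff_mem_nhds.2 fun y ⟨j, hy, h0⟩ => ?_
    filter_upwards [hφ.eventually_eq_zero hcont hy h0, S.U_mem_nhds hy] with z hz hzj
    exact ⟨j, hzj, hz⟩
  have hcompl : IsOpen Zᶜ := by
    refine isOpen_iff_mem_nhds.2 fun y hy => ?_
    obtain ⟨j, hyj⟩ := S.exists_mem_U y
    have hne : φ.toFun j y ≠ 0 := fun h0 => hy ⟨j, hyj, h0⟩
    filter_upwards [(φ.mdifferentiableAt hyj).continuousAt.eventually_ne hne, S.U_mem_nhds hyj]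
      with z hz hzj ⟨k, hzk, h0⟩
    exact hz (φ.eq_zero_of_eq_zero hzj hzk h0)
  obtain hZ | hZ := isClopen_iff.1 ⟨isOpen_compl_iff.1 hcompl, hopen⟩
  · exact fun h0 => Set.eq_empty_iff_forall_notMem.1 hZ x ⟨i, hx, h0⟩
  · obtain ⟨j, y, hy, hne⟩ := hφ0
    obtain ⟨k, hyk, h0⟩ : y ∈ Z := hZ ▸ Set.mem_univ y
    exact absurd (φ.eq_zero_of_eq_zero hy hyk h0) hne

end SpinorField

end NowhereVanishing

section LeviCivita

open VectorField

variable {m : ℕ} {M : Type*} [TopologicalSpace M]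
  [ChartedSpace (EuclideanSpace ℝ (Fin (m + 1))) M] [IsManifold (𝓡 (m + 1)) ∞ M]
  {g : LorentzianMetric m M} {nabla : Connection m M} {ι : Type*}

lemma IsLeviCivita.two_mul_metric_nabla_frame (hnabla : IsLeviCivita g nabla)
    (S : SpinStructure g ι) {i : ι} {x : M} (hx : x ∈ S.U i) (a b c : Fin (m + 1)) :
    2 * g.val x (nabla (S.frame i a) x (S.frame i b x)) (S.frame i c x) =
      g.val x (mlieBracket (𝓡 (m + 1)) (S.frame i b) (S.frame i a) x) (S.frame i c x) -
      g.val x (mlieBracket (𝓡 (m + 1)) (S.frame i a) (S.frame i c) x) (S.frame i b x) +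
      g.val x (mlieBracket (𝓡 (m + 1)) (S.frame i c) (S.frame i b) x) (S.frame i a x) := by
  have : IsManifold (𝓡 (m + 1)) 2 M := IsManifold.of_le (n := ∞) (by norm_cast)
  have htorsion (p q : Fin (m + 1)) :
      mlieBracket (𝓡 (m + 1)) (S.frame i p) (S.frame i q) x =
        nabla (S.frame i q) x (S.frame i p x) - nabla (S.frame i p) x (S.frame i q x) :=
    (nabla.torsion_eq_zero_iff.1 hnabla.torsion_eq_zero
      (S.mdifferentiableAt_frame hx p) (S.mdifferentiableAt_frame hx q)).symm
  have hskew (p q r : Fin (m + 1)) :=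
    S.metric_nabla_frame_antisymm hnabla.metric hx (S.frame i p x) q r
  simp only [htorsion, map_sub, sub_apply]
  linear_combination hskew a c b + hskew b a c - hskew c a b

lemma SpinStructure.continuousAt_metric_mlieBracket_frame (S : SpinStructure g ι) {i : ι} {x : M}
    (hx : x ∈ S.U i) (a b c : Fin (m + 1)) :
    ContinuousAt (fun y => g.val y
      (mlieBracket (𝓡 (m + 1)) (S.frame i a) (S.frame i b) y) (S.frame i c y)) x := by
  have : IsManifold (𝓡 (m + 1)) (((⊤ : ℕ∞) : WithTop ℕ∞) + 1) M := by simpa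
  have : IsManifold (𝓡 (m + 1)) (minSmoothness ℝ 2) M := by
    simpa using IsManifold.of_le (n := ∞) (by norm_cast)
  exact continuousAt_metric
    (ContMDiffAt.mlieBracket_vectorField (m := 0) (n := ⊤) (S.contMDiffAt_frame hx a)
      (S.contMDiffAt_frame hx b) (by simp))
    ((S.contMDiffAt_frame hx c).of_le (by simp))

lemma IsLeviCivita.hasContinuousCoefficients (hnabla : IsLeviCivita g nabla)
    (S : SpinStructure g ι) : S.HasContinuousCoefficients nabla := by
  intro i a b c x hx
  have hbracket (p q r : Fin (m + 1)) := S.continuousAt_metric_mlieBracket_frame hx p q r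
  refine ((((hbracket b a c).sub (hbracket a c b)).add (hbracket c b a)).const_mul
    (1 / 2)).continuousWithinAt.congr_of_mem (fun y hy => ?_) hx
  simp only [Pi.add_apply, Pi.sub_apply]
  rw [← hnabla.two_mul_metric_nabla_frame S hy]
  ring

end LeviCivita

end SpinLorentz

end

theorem mainTheorem9_general {m : ℕ} {M : Type*} [TopologicalSpace M] [ConnectedSpace M]
    [ChartedSpace (EuclideanSpace ℝ (Fin (m + 1))) M] [IsManifold (𝓡 (m + 1)) ∞ M]
    (g : SpinLorentz.LorentzianMetric m M)
    (nabla : SpinLorentz.Connection m M) (hnabla : SpinLorentz.IsMetric g nabla)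
    {ι : Type*} (S : SpinLorentz.SpinStructure g ι) (hcont : S.HasContinuousCoefficients nabla)
    (φ : SpinLorentz.SpinorField S) (hφ : φ.IsParallel nabla) (hφ0 : φ.IsNontrivial) :
    (∃! V : ∀ x : M, TangentSpace (𝓡 (m + 1)) x, φ.IsDiracCurrent V) ∧
    ∀ V : ∀ x : M, TangentSpace (𝓡 (m + 1)) x, φ.IsDiracCurrent V →
      ContMDiff (𝓡 (m + 1)) (𝓡 (m + 1)).tangent ∞
        (fun x => (⟨x, V x⟩ : TangentBundle (𝓡 (m + 1)) M)) ∧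
      (∀ x, V x ≠ 0) ∧
      (∀ (x : M) (X : TangentSpace (𝓡 (m + 1)) x), nabla V x X = 0) ∧
      (∀ x, g.val x (V x) (V x) ≤ 0) := by
  refine ⟨φ.existsUnique_isDiracCurrent, fun V hV => ⟨hV.contMDiff, fun x => ?_,
    hV.nabla_eq_zero hnabla hφ, hV.metric_self_nonpos⟩⟩
  obtain ⟨i, hx⟩ := S.exists_mem_U x
  exact hV.ne_zero_of_ne_zero hx (hφ.ne_zero hcont hφ0 hx)

theorem mainTheorem9 {m : ℕ} {M : Type*} [TopologicalSpace M] [T2Space M]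
    [SecondCountableTopology M] [ConnectedSpace M]
    [ChartedSpace (EuclideanSpace ℝ (Fin (m + 1))) M] [IsManifold (𝓡 (m + 1)) ∞ M]
    (g : SpinLorentz.LorentzianMetric m M)
    (nabla : SpinLorentz.Connection m M) (hnabla : SpinLorentz.IsLeviCivita g nabla)
    {ι : Type*} (S : SpinLorentz.SpinStructure g ι)
    (φ : SpinLorentz.SpinorField S) (hφ : φ.IsParallel nabla) (hφ0 : φ.IsNontrivial) :
    (∃! V : ∀ x : M, TangentSpace (𝓡 (m + 1)) x, φ.IsDiracCurrent V) ∧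
    ∀ V : ∀ x : M, TangentSpace (𝓡 (m + 1)) x, φ.IsDiracCurrent V →
      ContMDiff (𝓡 (m + 1)) (𝓡 (m + 1)).tangent ∞
        (fun x => (⟨x, V x⟩ : TangentBundle (𝓡 (m + 1)) M)) ∧
      (∀ x, V x ≠ 0) ∧
      (∀ (x : M) (X : TangentSpace (𝓡 (m + 1)) x), nabla V x X = 0) ∧
      (∀ x, g.val x (V x) (V x) ≤ 0) :=
  mainTheorem9_general g nabla hnabla.metric S (hnabla.hasContinuousCoefficients S) φ hφ hφ0
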